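/- Let $\epsilon > 0$. For each $n \geq 1$ let $z = z^{(n)} \in \{\pm 1\}^n$ be deterministic, let $W = W^{(n)}$ be a random symmetric $n \times n$ real matrix whose entries $W_{ij}$, $i < j$, are independent standard normal random variables (the diagonal entries are arbitrary), and let $$C = z z^T + \sigma W,$$ where the noise level $\sigma = \sigma_n \geq 0$ may depend on $n$ and satisfies, for all sufficiently large $n$, $$\sigma \leq \sqrt{\frac{n}{(2+\epsilon) \log n}}.$$ For an integer $r \geq 2$ consider the problem $$\max_{Y \in \mathbf{R}^{n \times r}} \ \langle C, Y Y^T \rangle = \sum_{i,j=1}^n C_{ij} \langle y_i, y_j \rangle \quad \text{subject to} \quad \operatorname{diag}(Y Y^T) = \mathbf{1},$$ where $y_1, \dots, y_n \in \mathbf{R}^r$ are the rows of $Y$, so that the constraint set is the product of unit spheres $(S^{r-1})^n$, a Riemannian submanifold of $\mathbf{R}^{n \times r}$. A feasible $Y$ is called a second-order critical point if the Riemannian gradient of the objective function vanishes at $Y$ and its Riemannian Hessian at $Y$ is negative semidefinite. Then, with probability tending to $1$ as $n \to \infty$, the following holds simultaneously for all $r \geq 2$: every second-order critical point $Y$ of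 this problem satisfies $Y Y^T = z z^T$. -/

import Mathlib

/-- The space `ℝ^{n × r}` of `n`-tuples `Y = (y_1, …, y_n)` of vectors of `ℝ^r` (the rows of the
matrix `Y`), with the Euclidean (Frobenius) inner product. -/
abbrev Config (n r : ℕ) : Type :=
  PiLp 2 (fun _ : Fin n => EuclideanSpace ℝ (Fin r))

namespace Config

variable {n r : ℕ}

/-- `Y` viewed as an `n × r` matrix whose rows are `y_1, …, y_n`. -/
def toMatrix (Y : Config n r) : Matrix (Fin n) (Fin r) ℝ :=
  Matrix.of fun i k => Y i k

/-- Membership in the product of spheres `(S^{r-1})^n`, the constraint set `diag(Y Yᵀ) = 1`. -/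
def OnSpheres (Y : Config n r) : Prop :=
  ∀ i, ‖Y i‖ = 1

/-- Membership of `U` in the tangent space to the product of spheres at `Y`. -/
def IsTangent (Y U : Config n r) : Prop :=
  ∀ i, inner ℝ (Y i) (U i) = 0

/-- For `Y` on the product of spheres, the orthogonal projection of `U` onto the tangent space
at `Y`; the formula extends it smoothly to all `Y`. -/
noncomputable def tangentProj (Y U : Config n r) : Config n r :=
  WithLp.toLp 2 fun i => U i - inner ℝ (Y i) (U i) • Y i

/-- The Riemannian gradient of (the restriction to the product of spheres of) `f`: the tangential
part of the Euclidean gradient. -/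
noncomputable def riemGradient (f : Config n r → ℝ) (Y : Config n r) : Config n r :=
  tangentProj Y (gradient f Y)

/-- The Riemannian Hessian of (the restriction to the product of spheres of) `f` at `Y`, applied to
a tangent vector `U`: the covariant derivative of the Riemannian gradient in the direction `U`,
which for a submanifold of a Euclidean space is the tangential part of the Euclidean derivative. -/
noncomputable def riemHessian (f : Config n r → ℝ) (Y U : Config n r) : Config n r :=
  tangentProj Y (fderiv ℝ (riemGradient f) Y U)

/-- `Y` is a second-order critical point of the problem of maximizing `f` over the product of
spheres: `Y` is feasible, the Riemannian gradient vanishes at `Y`, and the Riemannian Hessian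
at `Y` is negative semidefinite on the tangent space. -/
structure IsSecondOrderCritical (f : Config n r → ℝ) (Y : Config n r) : Prop where
  onSpheres : OnSpheres Y
  gradient_eq_zero : riemGradient f Y = 0
  hessian_nonpos : ∀ U : Config n r, IsTangent Y U → inner ℝ U (riemHessian f Y U) ≤ 0

end Config

/-- The objective function `∑_{i,j} C_{ij} ⟨y_i, y_j⟩ = ⟨C, Y Yᵀ⟩`. -/
noncomputable def syncObjective {n : ℕ} (C : Matrix (Fin n) (Fin n) ℝ) (r : ℕ)
    (Y : Config n r) : ℝ :=
  ∑ i, ∑ j, C i j * inner ℝ (Y i) (Y j)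

/-- `W` is a random symmetric matrix whose entries above the diagonal are independent standard
normal random variables. Nothing is required of the diagonal. -/
structure IsGaussianNoise {Ω : Type*} [MeasurableSpace Ω] (P : MeasureTheory.Measure Ω) {n : ℕ}
    (W : Ω → Matrix (Fin n) (Fin n) ℝ) : Prop where
  symm : ∀ ω, (W ω).IsSymm
  law : ∀ i j : Fin n, i < j →
    ProbabilityTheory.HasLaw (fun ω => W ω i j) (ProbabilityTheory.gaussianReal 0 1) P
  indep : ProbabilityTheory.iIndepFun
    (fun (p : {p : Fin n × Fin n // p.1 < p.2}) ω => W ω p.1.1 p.1.2) P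

/-!
Replacing `y i` by `z i • y i` and subtracting the diagonal of the noise, we may assume that
`C = 1 1ᵀ + A`, where `A` has zero diagonal, `‖A‖ ≤ η n` for a small `η`, and every row of `A` sums
to at least `-t n` for some `t < 1`. Let `s = ∑ y i = ‖s‖ h` with `‖h‖ = 1`, and let
`B = ∑ (1 - ⟪y i, h⟫) = n - ‖s‖`.

* The second order condition, averaged over the tangential projections of the vectors of an
  orthonormal basis, bounds `‖s‖` below by a multiple of `n`.
* Stationarity reads `l i • y i - s = ∑ A i j • y j`, so `y i` is nearly parallel to `h`; as the
  multipliers `l i` are nonnegative, `B` is at most a small multiple of `n`.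
* Pairing stationarity with `1 - ⟪y i, h⟫` gives
  `0 ≤ ∑ l i (1 - ⟪y i, h⟫)² ≤ 2 B (2 ‖A‖ + t n - ‖s‖)`. The last factor is negative, since
  `‖s‖ = n - B` is close to `n`, and therefore `B = 0`, that is, `y i = h` for all `i`.

The noise level enters through two events: a net argument gives `‖W‖ ≤ 16 √n` off the diagonal, and
a union bound over the `n` rows bounds the row sums below by `-t √((2 + ε) n log n)`. The latter
fails with probability at most `n ^ (1 - t² (1 + ε / 2))`, which tends to `0` when `t` is close
enough to `1`.
-/

section GramSums

open scoped InnerProductSpace Matrix.Norms.L2Operator TensorProduct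

variable {ι κ E : Type*} [Fintype ι] [Fintype κ] [DecidableEq κ]
  [NormedAddCommGroup E] [InnerProductSpace ℝ E] [FiniteDimensional ℝ E]

lemma sum_norm_sum_smul_sq_le (A : Matrix ι κ ℝ) (u : κ → E) :
    ∑ i, ‖∑ j, A i j • u j‖ ^ 2 ≤ ‖A‖ ^ 2 * ∑ j, ‖u j‖ ^ 2 := by
  have scalar (x : κ → ℝ) : ∑ i, (A.mulVec x i) ^ 2 ≤ ‖A‖ ^ 2 * ∑ j, x j ^ 2 := by
    have h := pow_le_pow_left₀ (norm_nonneg _) (A.l2_opNorm_mulVec (WithLp.toLp 2 x)) 2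
    simpa only [mul_pow, EuclideanSpace.real_norm_sq_eq, PiLp.continuousLinearEquiv_symm_apply]
      using h
  let b := stdOrthonormalBasis ℝ E
  calc ∑ i, ‖∑ j, A i j • u j‖ ^ 2
      = ∑ k, ∑ i, (A.mulVec (fun j => ⟪b k, u j⟫_ℝ) i) ^ 2 := by
        rw [Finset.sum_comm]
        simp only [← b.sum_sq_inner_right, inner_sum, real_inner_smul_right, Matrix.mulVec,
          dotProduct]
    _ ≤ ∑ k, ‖A‖ ^ 2 * ∑ j, ⟪b k, u j⟫_ℝ ^ 2 := Finset.sum_le_sum fun k _ => scalar _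
    _ = ‖A‖ ^ 2 * ∑ j, ‖u j‖ ^ 2 := by
        rw [← Finset.mul_sum, Finset.sum_comm]
        simp only [b.sum_sq_inner_right]

lemma abs_sum_mul_inner_le [DecidableEq ι] (A : Matrix ι ι ℝ) (u : ι → E) :
    |∑ i, ∑ j, A i j * ⟪u i, u j⟫_ℝ| ≤ ‖A‖ * ∑ i, ‖u i‖ ^ 2 := by
  let U : PiLp 2 fun _ : ι => E := WithLp.toLp 2 u
  let V : PiLp 2 fun _ : ι => E := WithLp.toLp 2 fun i => ∑ j, A i j • u j
  have hV : ‖V‖ ≤ ‖A‖ * ‖U‖ := by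
    refine le_of_sq_le_sq ?_ (by positivity)
    simpa only [mul_pow, PiLp.norm_sq_eq_of_L2] using sum_norm_sum_smul_sq_le A u
  calc |∑ i, ∑ j, A i j * ⟪u i, u j⟫_ℝ| = |⟪U, V⟫_ℝ| := by
        simp only [PiLp.inner_apply, U, V, inner_sum, real_inner_smul_right]
    _ ≤ ‖U‖ * (‖A‖ * ‖U‖) := (abs_real_inner_le_norm U V).trans (by gcongr)
    _ = ‖A‖ * ∑ i, ‖u i‖ ^ 2 := by
        rw [mul_left_comm, ← sq, PiLp.norm_sq_eq_of_L2]

lemma sum_norm_sq_sq_le_finrank_mul (y : ι → E) :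
    (∑ i, ‖y i‖ ^ 2) ^ 2 ≤ Module.finrank ℝ E * ∑ i, ∑ j, ⟪y i, y j⟫_ℝ ^ 2 := by
  let b := stdOrthonormalBasis ℝ E
  -- Cauchy–Schwarz in `E ⊗ E` against the identity tensor, whose squared norm is `finrank ℝ E`.
  let I : E ⊗[ℝ] E := ∑ k, b k ⊗ₜ[ℝ] b k
  let S : E ⊗[ℝ] E := ∑ i, y i ⊗ₜ[ℝ] y i
  have hIS : ⟪I, S⟫_ℝ = ∑ i, ‖y i‖ ^ 2 := by
    simp only [I, S, sum_inner, inner_sum, TensorProduct.inner_tmul, ← b.sum_sq_inner_right, ← sq]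
  have hII : ⟪I, I⟫_ℝ = Module.finrank ℝ E := by
    simp [I, sum_inner, inner_sum, TensorProduct.inner_tmul, b.inner_eq_ite]
  have hSS : ⟪S, S⟫_ℝ = ∑ i, ∑ j, ⟪y i, y j⟫_ℝ ^ 2 := by
    simp only [S, sum_inner, inner_sum, TensorProduct.inner_tmul, ← sq, real_inner_comm]
  have h := real_inner_mul_inner_self_le I S
  rwa [hIS, hII, hSS, ← sq] at h

end GramSums

section SecondOrderPoints

open scoped InnerProductSpace Matrix.Norms.L2Operator TensorProduct

variable {ι E : Type*} [Fintype ι] [NormedAddCommGroup E] [InnerProductSpace ℝ E]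

lemma sum_mul_sub_eq_zero {A : Matrix ι ι ℝ} (hA : A.IsSymm) (f : ι → ℝ) :
    ∑ i, ∑ j, A i j * (f i - f j) = 0 := by
  simp only [mul_sub, Finset.sum_sub_distrib]
  rw [sub_eq_zero, Finset.sum_comm]
  simp only [hA.apply]

lemma one_sub_inner_mul_sq_le {u v : E} (hu : ‖u‖ = 1) (hv : ‖v‖ = 1) {a b : ℝ} (ha : 0 ≤ a)
    (hb : 0 ≤ b) : (1 - ⟪u, v⟫_ℝ) * b ^ 2 ≤ 2 * ‖a • u - b • v‖ ^ 2 := by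
  have hnorm : ‖a • u - b • v‖ ^ 2 = a ^ 2 + b ^ 2 - 2 * (a * b * ⟪u, v⟫_ℝ) := by
    rw [norm_sub_sq_real, norm_smul, norm_smul, hu, hv, real_inner_smul_left,
      real_inner_smul_right, mul_one, mul_one, Real.norm_eq_abs, Real.norm_eq_abs, sq_abs, sq_abs]
    ring
  obtain ⟨hc, hc'⟩ := abs_le.1 (abs_real_inner_le_norm u v)
  rw [hu, hv, one_mul] at hc hc'
  rw [hnorm]
  generalize ⟪u, v⟫_ℝ = c at *
  rcases le_total 0 c with h | h
  · -- `2 (a² + b² - 2abc) - (1 - c) b² = 2 (a - bc)² + (1 - c) (1 + 2c) b²`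
    nlinarith [sq_nonneg (a - b * c), mul_nonneg (mul_nonneg h (sub_nonneg.2 hc')) (sq_nonneg b),
      mul_nonneg (sub_nonneg.2 hc') (sq_nonneg b)]
  · nlinarith [mul_nonneg (mul_nonneg ha hb) (neg_nonneg.2 h), sq_nonneg a,
      mul_nonneg (neg_le_iff_add_nonneg.1 hc) (sq_nonneg b)]

lemma exists_norm_eq_one_inner_eq_zero (hE : 2 ≤ Module.finrank ℝ E) (x : E) :
    ∃ v : E, ‖v‖ = 1 ∧ ⟪x, v⟫_ℝ = 0 := by
  have : FiniteDimensional ℝ E := FiniteDimensional.of_finrank_pos (by omega)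
  have hx : Module.finrank ℝ (ℝ ∙ x) ≤ 1 := (finrank_span_le_card {x}).trans (by simp)
  have hx' := Submodule.finrank_add_finrank_orthogonal (ℝ ∙ x)
  have : Nontrivial (ℝ ∙ x)ᗮ := Module.nontrivial_of_finrank_pos (R := ℝ) (by omega)
  obtain ⟨v, hv⟩ := exists_norm_eq (ℝ ∙ x)ᗮ zero_le_one
  exact ⟨v, hv, Submodule.mem_orthogonal_singleton_iff_inner_right.1 v.2⟩

lemma sum_one_sub_inner_eq {y : ι → E} {h : E} (hh : ‖h‖ = 1) {m : ℝ} (hs : ∑ i, y i = m • h) :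
    ∑ i, (1 - ⟪y i, h⟫_ℝ) = Fintype.card ι - m := by
  simp [Finset.sum_sub_distrib, ← sum_inner, hs, real_inner_smul_left, hh]

lemma sum_one_sub_inner_mul_add_inner_sub_one {y : ι → E} {h : E} (hh : ‖h‖ = 1) {m : ℝ}
    (hs : ∑ i, y i = m • h) :
    ∑ i, ∑ j, ((1 - ⟪y i, h⟫_ℝ) * (1 - ⟪y j, h⟫_ℝ) + (⟪y i, y j⟫_ℝ - 1)) =
      -2 * m * ∑ i, (1 - ⟪y i, h⟫_ℝ) := by
  have sum_inner_inner : ∑ i, ∑ j, ⟪y i, y j⟫_ℝ = m ^ 2 := by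
    simp only [← inner_sum, ← sum_inner, hs, real_inner_self_eq_norm_sq, norm_smul, hh, mul_one,
      Real.norm_eq_abs, sq_abs]
  simp only [Finset.sum_add_distrib, Finset.sum_sub_distrib (f := fun j => ⟪_, y j⟫_ℝ),
    ← Finset.mul_sum, ← Finset.sum_mul]
  simp [sum_inner_inner, sum_one_sub_inner_eq hh hs]
  ring

lemma mul_half_le_mul_add_div {d a : ℝ} (hd : 2 ≤ d) (ha : 0 ≤ a) :
    (d - 1) * (a / 2) ≤ (d - 2) * a + a / d := by
  have hdiff : (d - 2) * a + a / d - (d - 1) * (a / 2) = (d - 1) * (d - 2) / (2 * d) * a := by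
    field_simp
    ring
  have : 0 ≤ (d - 1) * (d - 2) / (2 * d) * a :=
    mul_nonneg (div_nonneg (mul_nonneg (by linarith) (by linarith)) (by linarith)) ha
  linarith

/-- The first and second order conditions, in Lagrangian form, for unit vectors `y i` to maximize
`∑ i, ∑ j, C i j * ⟪y i, y j⟫`: the `l i` are the multipliers of the constraints `‖y i‖² = 1`, and
the second order condition is tested on the vectors tangent to the product of spheres. -/
structure IsSecondOrderPoint (C : Matrix ι ι ℝ) (y : ι → E) (l : ι → ℝ) : Prop where
  norm_eq_one : ∀ i, ‖y i‖ = 1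
  sum_smul_eq : ∀ i, ∑ j, C i j • y j = l i • y i
  sum_mul_inner_le : ∀ u : ι → E, (∀ i, ⟪y i, u i⟫_ℝ = 0) →
    ∑ i, ∑ j, C i j * ⟪u i, u j⟫_ℝ ≤ ∑ i, l i * ‖u i‖ ^ 2

namespace IsSecondOrderPoint

variable {C : Matrix ι ι ℝ} {y : ι → E} {l : ι → ℝ}

lemma inner_self_eq_one (hy : IsSecondOrderPoint C y l) (i : ι) : ⟪y i, y i⟫_ℝ = 1 := by
  rw [real_inner_self_eq_norm_sq, hy.norm_eq_one, one_pow]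

lemma norm_sub_sq_eq (hy : IsSecondOrderPoint C y l) {h : E} (hh : ‖h‖ = 1) (i : ι) :
    ‖y i - h‖ ^ 2 = 2 * (1 - ⟪y i, h⟫_ℝ) := by
  rw [norm_sub_sq_real, hy.norm_eq_one, hh]
  ring

lemma one_sub_inner_nonneg (hy : IsSecondOrderPoint C y l) {h : E} (hh : ‖h‖ = 1) (i : ι) :
    0 ≤ 1 - ⟪y i, h⟫_ℝ :=
  sub_nonneg.2 (real_inner_le_one_of_norm_eq_one (hy.norm_eq_one i) hh)

lemma eq_of_sum_one_sub_inner_eq_zero (hy : IsSecondOrderPoint C y l) {h : E} (hh : ‖h‖ = 1)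
    (hsum : ∑ i, (1 - ⟪y i, h⟫_ℝ) = 0) (i : ι) : y i = h := by
  have hi := (Finset.sum_eq_zero_iff_of_nonneg fun i _ => hy.one_sub_inner_nonneg hh i).1 hsum i
    (Finset.mem_univ i)
  rw [← sub_eq_zero, ← norm_eq_zero, ← sq_eq_zero_iff, hy.norm_sub_sq_eq hh, hi, mul_zero]

lemma multiplier_mul_inner (hy : IsSecondOrderPoint C y l) (h : E) (i : ι) :
    l i * ⟪y i, h⟫_ℝ = ∑ j, C i j * ⟪y j, h⟫_ℝ := by
  simpa only [sum_inner, real_inner_smul_left] using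
    (congrArg (fun v => ⟪v, h⟫_ℝ) (hy.sum_smul_eq i)).symm

lemma multiplier_eq (hy : IsSecondOrderPoint C y l) (i : ι) :
    l i = ∑ j, C i j * ⟪y i, y j⟫_ℝ := by
  have h := hy.multiplier_mul_inner (y i) i
  simpa only [hy.inner_self_eq_one, mul_one, real_inner_comm] using h

lemma sub_diagonal [DecidableEq ι] (hy : IsSecondOrderPoint C y l) (d : ι → ℝ) :
    IsSecondOrderPoint (C - Matrix.diagonal d) y (l - d) where
  norm_eq_one := hy.norm_eq_one
  sum_smul_eq i := by
    simp [sub_smul, hy.sum_smul_eq, Matrix.diagonal_apply, ite_smul]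
  sum_mul_inner_le u hu := by
    simpa [sub_mul, Matrix.diagonal_apply, Finset.sum_sub_distrib] using hy.sum_mul_inner_le u hu

lemma sign_smul [DecidableEq ι] (hy : IsSecondOrderPoint C y l) {z : ι → ℝ}
    (hz : ∀ i, z i * z i = 1) :
    IsSecondOrderPoint (Matrix.diagonal z * C * Matrix.diagonal z) (fun i => z i • y i) l where
  norm_eq_one i := by
    have : |z i| = 1 := by nlinarith [abs_mul_abs_self (z i), abs_nonneg (z i), hz i]
    rw [norm_smul, Real.norm_eq_abs, this, hy.norm_eq_one, one_mul]
  sum_smul_eq i := by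
    calc ∑ j, (Matrix.diagonal z * C * Matrix.diagonal z) i j • z j • y j
        = z i • ∑ j, C i j • y j := by
          rw [Finset.smul_sum]
          refine Finset.sum_congr rfl fun j _ => ?_
          rw [Matrix.mul_diagonal, Matrix.diagonal_mul, smul_smul, smul_smul, mul_assoc, hz,
            mul_one]
      _ = l i • z i • y i := by rw [hy.sum_smul_eq, smul_comm]
  sum_mul_inner_le u hu := by
    have h := hy.sum_mul_inner_le (fun i => z i • u i) fun i => by
      rw [real_inner_smul_right, ← real_inner_smul_left, hu]
    calc ∑ i, ∑ j, (Matrix.diagonal z * C * Matrix.diagonal z) i j * ⟪u i, u j⟫_ℝ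
        = ∑ i, ∑ j, C i j * ⟪z i • u i, z j • u j⟫_ℝ := by
          refine Finset.sum_congr rfl fun i _ => Finset.sum_congr rfl fun j _ => ?_
          rw [Matrix.mul_diagonal, Matrix.diagonal_mul, real_inner_smul_left,
            real_inner_smul_right]
          ring
      _ ≤ ∑ i, l i * ‖z i • u i‖ ^ 2 := h
      _ = ∑ i, l i * ‖u i‖ ^ 2 := by
          refine Finset.sum_congr rfl fun i _ => ?_
          rw [norm_smul, mul_pow, Real.norm_eq_abs, sq_abs, sq, hz, one_mul]

lemma diag_le (hy : IsSecondOrderPoint C y l) (hE : 2 ≤ Module.finrank ℝ E) (i : ι) :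
    C i i ≤ l i := by
  classical
  obtain ⟨v, hv, hyv⟩ := exists_norm_eq_one_inner_eq_zero hE (y i)
  have h := hy.sum_mul_inner_le (Pi.single i v) fun j => by
    rcases eq_or_ne j i with rfl | hj
    · rw [Pi.single_eq_same, hyv]
    · rw [Pi.single_eq_of_ne hj, inner_zero_right]
  have single_sum (f : ι → ℝ) (hf : ∀ j ≠ i, f j = 0) : ∑ j, f j = f i :=
    Fintype.sum_eq_single i hf
  rw [single_sum _ fun j hj => by simp [Pi.single_eq_of_ne hj],
    single_sum _ fun j hj => by simp [Pi.single_eq_of_ne hj],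
    single_sum _ fun j hj => by simp [Pi.single_eq_of_ne hj]] at h
  simpa [hv] using h

/-- The second order condition, summed over the projections to the tangent space of the constant
families `fun _ => b k`, where `b` is an orthonormal basis. -/
lemma sum_mul_inner_sq_le [FiniteDimensional ℝ E] (hy : IsSecondOrderPoint C y l) :
    ∑ i, ∑ j, C i j * (Module.finrank ℝ E - 2 + ⟪y i, y j⟫_ℝ ^ 2) ≤
      (Module.finrank ℝ E - 1) * ∑ i, l i := by
  let b := stdOrthonormalBasis ℝ E
  let u (k : Fin (Module.finrank ℝ E)) (i : ι) : E := b k - ⟪y i, b k⟫_ℝ • y i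
  have hu (k i) : ⟪y i, u k i⟫_ℝ = 0 := by
    rw [inner_sub_right, real_inner_smul_right, hy.inner_self_eq_one, mul_one, sub_self]
  have inner_u (k i j) : ⟪u k i, u k j⟫_ℝ = 1 - ⟪y i, b k⟫_ℝ * ⟪b k, y i⟫_ℝ -
      ⟪y j, b k⟫_ℝ * ⟪b k, y j⟫_ℝ + ⟪y i, b k⟫_ℝ * ⟪b k, y j⟫_ℝ * ⟪y i, y j⟫_ℝ := by
    simp only [u, inner_sub_left, inner_sub_right, real_inner_smul_left, real_inner_smul_right,
      b.inner_eq_one, real_inner_comm (b k)]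
    ring
  have sum_inner_u (i j) : ∑ k, ⟪u k i, u k j⟫_ℝ = Module.finrank ℝ E - 2 + ⟪y i, y j⟫_ℝ ^ 2 := by
    simp only [inner_u, Finset.sum_add_distrib, Finset.sum_sub_distrib, ← Finset.sum_mul,
      b.sum_inner_mul_inner, hy.inner_self_eq_one, Finset.sum_const, Finset.card_univ,
      Fintype.card_fin, nsmul_eq_mul]
    ring
  calc ∑ i, ∑ j, C i j * (Module.finrank ℝ E - 2 + ⟪y i, y j⟫_ℝ ^ 2)
      = ∑ k, ∑ i, ∑ j, C i j * ⟪u k i, u k j⟫_ℝ := by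
        simp only [← sum_inner_u, Finset.mul_sum]
        exact Finset.sum_comm_cycle
    _ ≤ ∑ k, ∑ i, l i * ‖u k i‖ ^ 2 :=
        Finset.sum_le_sum fun k _ => hy.sum_mul_inner_le (u k) (hu k)
    _ = (Module.finrank ℝ E - 1) * ∑ i, l i := by
        rw [Finset.sum_comm, Finset.mul_sum]
        refine Finset.sum_congr rfl fun i _ => ?_
        simp only [← Finset.mul_sum, ← real_inner_self_eq_norm_sq, sum_inner_u,
          hy.inner_self_eq_one]
        ring

/-- With `L = diagonal l - C`, the left-hand side is the quadratic form of `L` at the vector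
`1 - a`, where `a i = ⟪y i, h⟫`; stationarity says that `L` kills `a`. -/
lemma sum_multiplier_mul_sq_eq (hy : IsSecondOrderPoint C y l) (hC : C.IsSymm) (h : E) :
    ∑ i, l i * (1 - ⟪y i, h⟫_ℝ) ^ 2 =
      ∑ i, ∑ j, C i j * ((1 - ⟪y i, h⟫_ℝ) * (1 - ⟪y j, h⟫_ℝ) + (⟪y i, y j⟫_ℝ - 1)) := by
  have expand (i : ι) : l i * (1 - ⟪y i, h⟫_ℝ) ^ 2 =
      ∑ j, C i j * (⟪y i, y j⟫_ℝ - 2 * ⟪y j, h⟫_ℝ + ⟪y i, h⟫_ℝ * ⟪y j, h⟫_ℝ) := by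
    calc l i * (1 - ⟪y i, h⟫_ℝ) ^ 2
        = l i - 2 * (l i * ⟪y i, h⟫_ℝ) + ⟪y i, h⟫_ℝ * (l i * ⟪y i, h⟫_ℝ) := by ring
      _ = _ := by
          rw [hy.multiplier_mul_inner, hy.multiplier_eq, Finset.mul_sum, Finset.mul_sum,
            ← Finset.sum_sub_distrib, ← Finset.sum_add_distrib]
          exact Finset.sum_congr rfl fun j _ => by ring
  rw [← sub_eq_zero, ← sum_mul_sub_eq_zero hC fun i => ⟪y i, h⟫_ℝ]
  simp only [expand, ← Finset.sum_sub_distrib]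
  exact Finset.sum_congr rfl fun i _ => Finset.sum_congr rfl fun j _ => by ring

lemma sum_mul_inner_sub_one_le [DecidableEq ι] [FiniteDimensional ℝ E] {A : Matrix ι ι ℝ}
    (hA : A.IsSymm) (hy : IsSecondOrderPoint C y l) {ρ : ℝ} (hρ : ∀ i, -ρ ≤ ∑ j, A i j) {h : E}
    (hh : ‖h‖ = 1) :
    ∑ i, ∑ j, A i j * (⟪y i, y j⟫_ℝ - 1) ≤ (‖A‖ + ρ) * ∑ i, ‖y i - h‖ ^ 2 := by
  have expand : ∑ i, ∑ j, A i j * (⟪y i, y j⟫_ℝ - 1) =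
      ∑ i, ∑ j, A i j * ⟪y i - h, y j - h⟫_ℝ + ∑ i, -(∑ j, A i j) * ‖y i - h‖ ^ 2 := by
    have inner_sub_sub (i j) :
        ⟪y i - h, y j - h⟫_ℝ = ⟪y i, y j⟫_ℝ - ⟪y i, h⟫_ℝ - ⟪y j, h⟫_ℝ + 1 := by
      rw [inner_sub_left, inner_sub_right, inner_sub_right, real_inner_self_eq_norm_sq, hh,
        real_inner_comm (y j) h]
      ring
    rw [← sub_eq_zero, ← sum_mul_sub_eq_zero hA fun i => -⟪y i, h⟫_ℝ]
    simp only [inner_sub_sub, hy.norm_sub_sq_eq hh, neg_mul, Finset.sum_mul,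
      ← Finset.sum_neg_distrib, ← Finset.sum_add_distrib, ← Finset.sum_sub_distrib]
    exact Finset.sum_congr rfl fun i _ => Finset.sum_congr rfl fun j _ => by ring
  rw [expand, add_mul, Finset.mul_sum (a := ρ)]
  gcongr with i
  · exact (le_abs_self _).trans (abs_sum_mul_inner_le A _)
  · exact neg_le.1 (hρ i)

section Perturbation

variable [DecidableEq ι] {A : Matrix ι ι ℝ}

lemma half_card_sq_sub_le_norm_sum_sq [FiniteDimensional ℝ E] (hE : 2 ≤ Module.finrank ℝ E)
    (hy : IsSecondOrderPoint (Matrix.vecMulVec 1 1 + A) y l) :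
    (Fintype.card ι : ℝ) ^ 2 / 2 - 2 * ‖A‖ * Fintype.card ι ≤ ‖∑ i, y i‖ ^ 2 := by
  set n : ℝ := (Fintype.card ι : ℝ) with hn
  set d : ℝ := (Module.finrank ℝ E : ℝ)
  have hd : 2 ≤ d := Nat.ofNat_le_cast.2 hE
  have hn_sum : ∑ _i : ι, ∑ _j : ι, (1 : ℝ) = n ^ 2 := by simp [hn, sq]
  have sum_l : ∑ i, l i = ‖∑ i, y i‖ ^ 2 + ∑ i, ∑ j, A i j * ⟪y i, y j⟫_ℝ := by
    simp only [hy.multiplier_eq, Matrix.add_apply, Matrix.vecMulVec_apply, Pi.one_apply, one_mul,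
      add_mul, Finset.sum_add_distrib, ← real_inner_self_eq_norm_sq, sum_inner, inner_sum,
      real_inner_comm]
  have hessian : (d - 2) * (n ^ 2 + ∑ i, ∑ j, A i j) + ∑ i, ∑ j, ⟪y i, y j⟫_ℝ ^ 2 +
      ∑ i, ∑ j, A i j * ⟪y i, y j⟫_ℝ ^ 2 ≤ (d - 1) * ∑ i, l i := by
    refine le_of_eq_of_le ?_ hy.sum_mul_inner_sq_le
    simp only [← hn_sum, Matrix.add_apply, Matrix.vecMulVec_apply, Pi.one_apply, one_mul, mul_add,
      Finset.mul_sum, ← Finset.sum_add_distrib]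
    exact Finset.sum_congr rfl fun i _ => Finset.sum_congr rfl fun j _ => by ring
  have gram_ge : n ^ 2 / d ≤ ∑ i, ∑ j, ⟪y i, y j⟫_ℝ ^ 2 := by
    have h := sum_norm_sq_sq_le_finrank_mul y
    simp only [hy.norm_eq_one, one_pow, Finset.sum_const, Finset.card_univ, nsmul_eq_mul, mul_one]
      at h
    rwa [div_le_iff₀' (by linarith)]
  have A_le : ∑ i, ∑ j, A i j * ⟪y i, y j⟫_ℝ ≤ ‖A‖ * n := by
    simpa [hy.norm_eq_one] using (abs_le.1 (abs_sum_mul_inner_le A y)).2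
  have A_one_ge : -(‖A‖ * n) ≤ ∑ i, ∑ j, A i j := by
    simpa using (abs_le.1 (abs_sum_mul_inner_le A fun _ => (1 : ℝ))).1
  have A_sq_ge : -(‖A‖ * n) ≤ ∑ i, ∑ j, A i j * ⟪y i, y j⟫_ℝ ^ 2 := by
    simpa [hy.norm_eq_one, ← sq] using
      (abs_le.1 (abs_sum_mul_inner_le A fun i => y i ⊗ₜ[ℝ] y i)).1
  have A_le' := mul_le_mul_of_nonneg_left A_le (by linarith : 0 ≤ d - 1)
  have A_one_ge' := mul_le_mul_of_nonneg_left A_one_ge (by linarith : 0 ≤ d - 2)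
  rw [sum_l] at hessian
  refine le_of_mul_le_mul_left ?_ (by linarith : 0 < d - 1)
  linarith [mul_half_le_mul_add_div hd (sq_nonneg n)]

lemma sum_one_sub_inner_mul_sq_le [FiniteDimensional ℝ E]
    (hy : IsSecondOrderPoint (Matrix.vecMulVec 1 1 + A) y l) (hl : ∀ i, 0 ≤ l i) {h : E}
    (hh : ‖h‖ = 1) {m : ℝ} (hm : 0 ≤ m) (hs : ∑ i, y i = m • h) :
    (∑ i, (1 - ⟪y i, h⟫_ℝ)) * m ^ 2 ≤ 2 * (‖A‖ ^ 2 * Fintype.card ι) := by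
  have residual (i : ι) : l i • y i - m • h = ∑ j, A i j • y j := by
    simp [← hy.sum_smul_eq, ← hs, add_smul, Finset.sum_add_distrib]
  calc (∑ i, (1 - ⟪y i, h⟫_ℝ)) * m ^ 2
      ≤ ∑ i, 2 * ‖∑ j, A i j • y j‖ ^ 2 := by
        rw [Finset.sum_mul]
        refine Finset.sum_le_sum fun i _ => ?_
        rw [← residual]
        exact one_sub_inner_mul_sq_le (hy.norm_eq_one i) hh (hl i) hm
    _ ≤ 2 * (‖A‖ ^ 2 * ∑ i, ‖y i‖ ^ 2) := by
        rw [← Finset.mul_sum]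
        gcongr
        exact sum_norm_sum_smul_sq_le A y
    _ = 2 * (‖A‖ ^ 2 * Fintype.card ι) := by simp [hy.norm_eq_one]

lemma zero_le_sum_one_sub_inner_mul [FiniteDimensional ℝ E]
    (hy : IsSecondOrderPoint (Matrix.vecMulVec 1 1 + A) y l) (hA : A.IsSymm)
    (hl : ∀ i, 0 ≤ l i) {ρ : ℝ} (hρ : ∀ i, -ρ ≤ ∑ j, A i j) {h : E} (hh : ‖h‖ = 1) {m : ℝ}
    (hs : ∑ i, y i = m • h) :
    0 ≤ (∑ i, (1 - ⟪y i, h⟫_ℝ)) * (2 * ‖A‖ + ρ - m) := by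
  set B := ∑ i, (1 - ⟪y i, h⟫_ℝ) with hB
  have hC : (Matrix.vecMulVec 1 1 + A).IsSymm := by
    refine Matrix.IsSymm.add ?_ hA
    rw [Matrix.IsSymm, Matrix.transpose_vecMulVec]
  have ones_part := sum_one_sub_inner_mul_add_inner_sub_one hh hs
  rw [← hB] at ones_part
  have square_part : ∑ i, ∑ j, A i j * ((1 - ⟪y i, h⟫_ℝ) * (1 - ⟪y j, h⟫_ℝ)) ≤
      ‖A‖ * (2 * B) := by
    calc _ ≤ ‖A‖ * ∑ i, ‖1 - ⟪y i, h⟫_ℝ‖ ^ 2 := by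
          simpa [mul_comm] using
            (abs_le.1 (abs_sum_mul_inner_le A fun i => 1 - ⟪y i, h⟫_ℝ)).2
      _ ≤ ‖A‖ * (2 * B) := by
          rw [hB, Finset.mul_sum (a := 2)]
          gcongr with i
          have hle := real_inner_le_one_of_norm_eq_one (hy.norm_eq_one i) hh
          have hge := neg_one_le_real_inner_of_norm_eq_one (hy.norm_eq_one i) hh
          rw [Real.norm_eq_abs, sq_abs]
          nlinarith
  have inner_part : ∑ i, ∑ j, A i j * (⟪y i, y j⟫_ℝ - 1) ≤ (‖A‖ + ρ) * (2 * B) := by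
    simpa only [hy.norm_sub_sq_eq hh, ← Finset.mul_sum] using
      hy.sum_mul_inner_sub_one_le hA hρ hh
  have total : ∑ i, l i * (1 - ⟪y i, h⟫_ℝ) ^ 2 ≤ 2 * (B * (2 * ‖A‖ + ρ - m)) := by
    rw [hy.sum_multiplier_mul_sq_eq hC]
    simp only [Matrix.add_apply, Matrix.vecMulVec_apply, Pi.one_apply, one_mul, add_mul, mul_add,
      Finset.sum_add_distrib] at ones_part ⊢
    linarith
  have : 0 ≤ ∑ i, l i * (1 - ⟪y i, h⟫_ℝ) ^ 2 :=
    Finset.sum_nonneg fun i _ => mul_nonneg (hl i) (sq_nonneg _)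
  linarith

theorem eq_of_norm_le (hy : IsSecondOrderPoint (Matrix.vecMulVec 1 1 + A) y l)
    (hE : 2 ≤ Module.finrank ℝ E) (hA : A.IsSymm) (hdiag : ∀ i, -1 ≤ A i i) {η t : ℝ}
    (hη : η ≤ 1 / 8) (hηt : 8 * η ^ 2 + 2 * η < 1 - t) (hnorm : ‖A‖ ≤ η * Fintype.card ι)
    (hrow : ∀ i, -(t * Fintype.card ι) ≤ ∑ j, A i j) (i j : ι) : y i = y j := by
  have : FiniteDimensional ℝ E := FiniteDimensional.of_finrank_pos (by omega)
  have hl (i : ι) : 0 ≤ l i := by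
    have := hy.diag_le hE i
    simp only [Matrix.add_apply, Matrix.vecMulVec_apply, Pi.one_apply, mul_one] at this
    linarith [hdiag i]
  set n : ℝ := (Fintype.card ι : ℝ)
  have hn : 0 < n := Nat.cast_pos.2 (Fintype.card_pos_iff.2 ⟨i⟩)
  set s := ∑ i, y i
  have hs_ge : n ^ 2 / 4 ≤ ‖s‖ ^ 2 := by
    have := hy.half_card_sq_sub_le_norm_sum_sq hE
    nlinarith
  have hs_ne : s ≠ 0 := fun h0 => by
    rw [h0, norm_zero] at hs_ge
    nlinarith
  let h := NormedSpace.normalize s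
  have hh : ‖h‖ = 1 := NormedSpace.norm_normalize hs_ne
  have hsh : s = ‖s‖ • h := (NormedSpace.norm_smul_normalize s).symm
  set B := ∑ i, (1 - ⟪y i, h⟫_ℝ)
  have hB_nonneg : 0 ≤ B := Finset.sum_nonneg fun i _ => hy.one_sub_inner_nonneg hh i
  have hB_le : B ≤ 8 * η ^ 2 * n := by
    refine le_of_mul_le_mul_right ?_ (by positivity : 0 < n ^ 2 / 4)
    calc B * (n ^ 2 / 4) ≤ B * ‖s‖ ^ 2 := by gcongr
      _ ≤ 2 * (‖A‖ ^ 2 * n) := hy.sum_one_sub_inner_mul_sq_le hl hh (norm_nonneg s) hsh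
      _ ≤ 2 * ((η * n) ^ 2 * n) := by gcongr
      _ = 8 * η ^ 2 * n * (n ^ 2 / 4) := by ring
  have hB : B = 0 := by
    have hneg : 2 * ‖A‖ + t * n - ‖s‖ < 0 := by
      have : B = n - ‖s‖ := sum_one_sub_inner_eq hh hsh
      nlinarith
    have hnonneg := hy.zero_le_sum_one_sub_inner_mul hA hl hrow hh hsh
    exact le_antisymm (nonpos_of_mul_nonneg_left hnonneg hneg) hB_nonneg
  rw [hy.eq_of_sum_one_sub_inner_eq_zero hh hB i, hy.eq_of_sum_one_sub_inner_eq_zero hh hB j]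

end Perturbation

end IsSecondOrderPoint

end SecondOrderPoints

section RiemannianCritical

open scoped InnerProductSpace

section Product

variable {ι E : Type*} [Fintype ι] [NormedAddCommGroup E] [InnerProductSpace ℝ E]

/-- Only the tangential components of `G` and the scalars `⟪Y i, G Y i⟫` survive: along the line
`Y + t U` the subtracted normal part pairs with `U` to
`t * ∑ i, ⟪Y i + t U i, G (Y + t U) i⟫ * ‖U i‖ ^ 2`, because `⟪Y i, U i⟫ = 0`. -/
lemma inner_fderiv_sub_inner_smul {G : PiLp 2 (fun _ : ι => E) → PiLp 2 fun _ : ι => E}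
    {Y U : PiLp 2 fun _ : ι => E} (hG : DifferentiableAt ℝ G Y) (hU : ∀ i, ⟪Y i, U i⟫_ℝ = 0) :
    ⟪U, fderiv ℝ (fun Z => WithLp.toLp 2 fun i => G Z i - ⟪Z i, G Z i⟫_ℝ • Z i) Y U⟫_ℝ =
      ⟪U, fderiv ℝ G Y U⟫_ℝ - ∑ i, ⟪Y i, G Y i⟫_ℝ * ‖U i‖ ^ 2 := by
  let T (Z : PiLp 2 fun _ : ι => E) : PiLp 2 fun _ : ι => E :=
    WithLp.toLp 2 fun i => G Z i - ⟪Z i, G Z i⟫_ℝ • Z i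
  have apply_diff {H : PiLp 2 (fun _ : ι => E) → PiLp 2 fun _ : ι => E}
      (hH : DifferentiableAt ℝ H Y) (i : ι) : DifferentiableAt ℝ (fun Z => H Z i) Y :=
    (differentiableAt_piLp 2).1 hH i
  have hT : DifferentiableAt ℝ T Y := (differentiableAt_piLp 2).2 fun i =>
    (apply_diff hG i).sub
      (((apply_diff differentiableAt_id i).inner ℝ (apply_diff hG i)).smul
        (apply_diff differentiableAt_id i))
  let N (Z : PiLp 2 fun _ : ι => E) : ℝ := ∑ i, ⟪Z i, G Z i⟫_ℝ * ‖U i‖ ^ 2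
  have hN : DifferentiableAt ℝ N Y := DifferentiableAt.fun_sum fun i _ =>
    ((apply_diff differentiableAt_id i).inner ℝ (apply_diff hG i)).mul_const _
  have along_line (t : ℝ) : ⟪U, T (Y + t • U)⟫_ℝ = ⟪U, G (Y + t • U)⟫_ℝ - t * N (Y + t • U) := by
    have normal (i : ι) : ⟪U i, (Y + t • U) i⟫_ℝ = t * ‖U i‖ ^ 2 := by
      simp [inner_add_right, real_inner_comm (Y i), hU i, real_inner_smul_right]
    simp only [PiLp.inner_apply, T, N, Finset.mul_sum, ← Finset.sum_sub_distrib, inner_sub_right,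
      real_inner_smul_right, normal]
    exact Finset.sum_congr rfl fun i _ => by ring
  have deriv_line {H : PiLp 2 (fun _ : ι => E) → PiLp 2 fun _ : ι => E}
      (hH : DifferentiableAt ℝ H Y) :
      HasDerivAt (fun t : ℝ => ⟪U, H (Y + t • U)⟫_ℝ) ⟪U, fderiv ℝ H Y U⟫_ℝ 0 :=
    (innerSL ℝ U).hasFDerivAt.comp_hasDerivAt 0 (hH.hasFDerivAt.hasLineDerivAt U)
  have deriv_normal : HasDerivAt (fun t : ℝ => t * N (Y + t • U)) (N Y) 0 := by
    simpa using (hasDerivAt_id' (0 : ℝ)).fun_mul (hN.hasFDerivAt.hasLineDerivAt U)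
  have h := deriv_line hT
  simp only [along_line] at h
  exact h.unique ((deriv_line hG).sub deriv_normal)

/-- The action `(C Y) i = ∑ j, C i j • Y j` of a matrix on families of vectors, as an operator on
the `ℓ²` product; its quadratic form is the objective function of the synchronization problem. -/
noncomputable def familyOperator (C : Matrix ι ι ℝ) (E : Type*) [NormedAddCommGroup E]
    [InnerProductSpace ℝ E] : PiLp 2 (fun _ : ι => E) →L[ℝ] PiLp 2 fun _ : ι => E :=
  (PiLp.continuousLinearEquiv 2 ℝ fun _ : ι => E).symm ∘L
    ContinuousLinearMap.pi fun i => ∑ j, C i j • PiLp.proj 2 (fun _ : ι => E) j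

lemma familyOperator_apply (C : Matrix ι ι ℝ) (Y : PiLp 2 fun _ : ι => E) (i : ι) :
    familyOperator C E Y i = ∑ j, C i j • Y j := by
  simp [familyOperator]

lemma inner_familyOperator (C : Matrix ι ι ℝ) (U Y : PiLp 2 fun _ : ι => E) :
    ⟪U, familyOperator C E Y⟫_ℝ = ∑ i, ∑ j, C i j * ⟪U i, Y j⟫_ℝ := by
  simp only [PiLp.inner_apply, familyOperator_apply, inner_sum, real_inner_smul_right]

lemma isSymmetric_familyOperator {C : Matrix ι ι ℝ} (hC : C.IsSymm) :
    (familyOperator C E : PiLp 2 (fun _ : ι => E) →ₗ[ℝ] PiLp 2 fun _ : ι => E).IsSymmetric := by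
  intro U Y
  simp only [ContinuousLinearMap.coe_coe]
  rw [real_inner_comm, inner_familyOperator, inner_familyOperator, Finset.sum_comm]
  simp only [hC.apply, real_inner_comm]

lemma gradient_sum_mul_inner [CompleteSpace E] {C : Matrix ι ι ℝ} (hC : C.IsSymm) :
    gradient (fun Y : PiLp 2 fun _ : ι => E => ∑ i, ∑ j, C i j * ⟪Y i, Y j⟫_ℝ) =
      (2 : ℝ) • familyOperator C E := by
  funext Y
  refine HasGradientAt.gradient (hasGradientAt_iff_hasFDerivAt.2 ?_)
  have h := ((isSymmetric_familyOperator hC).hasStrictFDerivAt_reApplyInnerSelf Y).hasFDerivAt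
  convert! h using 1
  · funext Z
    rw [ContinuousLinearMap.reApplyInnerSelf_apply, RCLike.re_to_real, real_inner_comm,
      inner_familyOperator]
  · ext V
    simp [two_smul]

lemma gradient_sum_mul_inner_apply [CompleteSpace E] {C : Matrix ι ι ℝ} (hC : C.IsSymm)
    (Y : PiLp 2 fun _ : ι => E) (i : ι) :
    gradient (fun Y : PiLp 2 fun _ : ι => E => ∑ i, ∑ j, C i j * ⟪Y i, Y j⟫_ℝ) Y i =
      (2 : ℝ) • ∑ j, C i j • Y j := by
  rw [gradient_sum_mul_inner hC, Pi.smul_apply, PiLp.smul_apply, familyOperator_apply]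

lemma hasFDerivAt_gradient_sum_mul_inner [CompleteSpace E] {C : Matrix ι ι ℝ} (hC : C.IsSymm)
    (Y : PiLp 2 fun _ : ι => E) :
    HasFDerivAt (gradient fun Y : PiLp 2 fun _ : ι => E => ∑ i, ∑ j, C i j * ⟪Y i, Y j⟫_ℝ)
      ((2 : ℝ) • familyOperator C E) Y := by
  rw [gradient_sum_mul_inner hC]
  exact (familyOperator C E).hasFDerivAt.const_smul (2 : ℝ)

lemma inner_fderiv_gradient_sum_mul_inner [CompleteSpace E] {C : Matrix ι ι ℝ} (hC : C.IsSymm)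
    (Y U : PiLp 2 fun _ : ι => E) :
    ⟪U, fderiv ℝ
        (gradient fun Y : PiLp 2 fun _ : ι => E => ∑ i, ∑ j, C i j * ⟪Y i, Y j⟫_ℝ) Y U⟫_ℝ =
      2 * ∑ i, ∑ j, C i j * ⟪U i, U j⟫_ℝ := by
  rw [(hasFDerivAt_gradient_sum_mul_inner hC Y).fderiv, smul_apply, real_inner_smul_right,
    inner_familyOperator]

end Product

namespace Config

variable {n r : ℕ} {f : Config n r → ℝ} {Y U : Config n r}

lemma inner_tangentProj (hU : IsTangent Y U) (V : Config n r) :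
    ⟪U, tangentProj Y V⟫_ℝ = ⟪U, V⟫_ℝ := by
  rw [PiLp.inner_apply, PiLp.inner_apply]
  refine Finset.sum_congr rfl fun i _ => ?_
  rw [tangentProj, inner_sub_right, real_inner_smul_right, real_inner_comm (Y i) (U i), hU i,
    mul_zero, sub_zero]

lemma inner_riemHessian (hf : DifferentiableAt ℝ (gradient f) Y) (hU : IsTangent Y U) :
    ⟪U, riemHessian f Y U⟫_ℝ = ⟪U, fderiv ℝ (gradient f) Y U⟫_ℝ -
      ∑ i, ⟪Y i, gradient f Y i⟫_ℝ * ‖U i‖ ^ 2 := by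
  rw [riemHessian, inner_tangentProj hU]
  exact inner_fderiv_sub_inner_smul hf hU

lemma gradient_syncObjective_apply {C : Matrix (Fin n) (Fin n) ℝ} (hC : C.IsSymm) (i : Fin n) :
    gradient (syncObjective C r) Y i = (2 : ℝ) • ∑ j, C i j • Y j :=
  gradient_sum_mul_inner_apply hC Y i

lemma inner_riemHessian_syncObjective {C : Matrix (Fin n) (Fin n) ℝ} (hC : C.IsSymm)
    (hU : IsTangent Y U) :
    ⟪U, riemHessian (syncObjective C r) Y U⟫_ℝ = 2 * (∑ i, ∑ j, C i j * ⟪U i, U j⟫_ℝ -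
      ∑ i, ⟪Y i, ∑ j, C i j • Y j⟫_ℝ * ‖U i‖ ^ 2) := by
  have hdiff : DifferentiableAt ℝ (gradient (syncObjective C r)) Y :=
    (hasFDerivAt_gradient_sum_mul_inner hC Y).differentiableAt
  have hinner : ⟪U, fderiv ℝ (gradient (syncObjective C r)) Y U⟫_ℝ =
      2 * ∑ i, ∑ j, C i j * ⟪U i, U j⟫_ℝ := inner_fderiv_gradient_sum_mul_inner hC Y U
  rw [inner_riemHessian hdiff hU, hinner]
  simp only [gradient_syncObjective_apply hC, real_inner_smul_right, mul_assoc, mul_sub,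
    Finset.mul_sum]

lemma IsSecondOrderCritical.isSecondOrderPoint {C : Matrix (Fin n) (Fin n) ℝ} (hC : C.IsSymm)
    (hY : IsSecondOrderCritical (syncObjective C r) Y) :
    IsSecondOrderPoint C (fun i => Y i) fun i => ⟪Y i, ∑ j, C i j • Y j⟫_ℝ where
  norm_eq_one := hY.onSpheres
  sum_smul_eq i := by
    have h : gradient (syncObjective C r) Y i -
        ⟪Y i, gradient (syncObjective C r) Y i⟫_ℝ • Y i = 0 :=
      congrArg (fun Z : Config n r => Z i) hY.gradient_eq_zero
    rw [gradient_syncObjective_apply hC, real_inner_smul_right, mul_smul, ← smul_sub] at h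
    exact sub_eq_zero.1 ((smul_eq_zero.1 h).resolve_left two_ne_zero)
  sum_mul_inner_le u hu := by
    have h := hY.hessian_nonpos (WithLp.toLp 2 u) hu
    rw [inner_riemHessian_syncObjective hC hu] at h
    linarith

end Config

end RiemannianCritical

section ExactRecovery

open scoped InnerProductSpace Matrix.Norms.L2Operator

/-- For every rank `r ≥ 2`, each second-order critical point `Y` of the problem with cost matrix `C`
recovers `z` up to a global rotation: `Y Yᵀ = z zᵀ`. -/
def ExactRecovery {n : ℕ} (C : Matrix (Fin n) (Fin n) ℝ) (z : Fin n → ℝ) : Prop :=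
  ∀ r, 2 ≤ r → ∀ Y : Config n r, Config.IsSecondOrderCritical (syncObjective C r) Y →
    Y.toMatrix * Y.toMatrix.transpose = Matrix.vecMulVec z z

lemma Config.toMatrix_mul_transpose_apply {n r : ℕ} (Y : Config n r) (i j : Fin n) :
    (Y.toMatrix * Y.toMatrix.transpose) i j = ⟪Y i, Y j⟫_ℝ := by
  simp [Matrix.mul_apply, PiLp.inner_apply, Config.toMatrix, mul_comm]

section OffDiagonal

variable {ι : Type*} [DecidableEq ι] {A : Matrix ι ι ℝ} {z : ι → ℝ}

/-- `A` with its diagonal entries replaced by zeros. The diagonal of the noise is arbitrary, and it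
only shifts the objective function by a constant. -/
def offDiagPart (A : Matrix ι ι ℝ) : Matrix ι ι ℝ :=
  A - Matrix.diagonal A.diag

lemma offDiagPart_apply_self (i : ι) : offDiagPart A i i = 0 := by
  simp [offDiagPart]

lemma offDiagPart_apply_of_ne {i j : ι} (h : i ≠ j) : offDiagPart A i j = A i j := by
  simp [offDiagPart, h]

lemma isSymm_offDiagPart (hA : A.IsSymm) : (offDiagPart A).IsSymm :=
  hA.sub (Matrix.isSymm_diagonal _)

variable [Fintype ι]

lemma diagonal_mul_vecMulVec_add_smul_mul_diagonal (hz : ∀ i, z i * z i = 1) (σ : ℝ) :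
    Matrix.diagonal z * (Matrix.vecMulVec z z + σ • A - Matrix.diagonal (σ • A.diag)) *
        Matrix.diagonal z =
      Matrix.vecMulVec 1 1 + σ • (Matrix.diagonal z * offDiagPart A * Matrix.diagonal z) := by
  ext i j
  rw [add_sub_assoc, Matrix.diagonal_smul, ← smul_sub]
  simp only [Matrix.mul_diagonal, Matrix.diagonal_mul, Matrix.add_apply, Matrix.smul_apply,
    Matrix.vecMulVec_apply, Pi.one_apply, smul_eq_mul, offDiagPart]
  linear_combination z j * z j * hz i + hz j

lemma norm_diagonal_mul_mul_diagonal_le (hz : ∀ i, |z i| = 1) :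
    ‖Matrix.diagonal z * A * Matrix.diagonal z‖ ≤ ‖A‖ := by
  have hz_norm : ‖Matrix.diagonal z‖ ≤ 1 := by
    rw [Matrix.l2_opNorm_diagonal]
    exact (pi_norm_le_iff_of_nonneg zero_le_one).2 fun i => (hz i).le
  calc ‖Matrix.diagonal z * A * Matrix.diagonal z‖
      ≤ ‖Matrix.diagonal z‖ * ‖A‖ * ‖Matrix.diagonal z‖ :=
        (Matrix.l2_opNorm_mul _ _).trans
          (mul_le_mul_of_nonneg_right (Matrix.l2_opNorm_mul _ _) (norm_nonneg _))
    _ ≤ 1 * ‖A‖ * 1 := by gcongr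
    _ = ‖A‖ := by rw [one_mul, mul_one]

end OffDiagonal

theorem exactRecovery_of_norm_le {n : ℕ} {z : Fin n → ℝ} (hz : ∀ i, z i = 1 ∨ z i = -1)
    {W : Matrix (Fin n) (Fin n) ℝ} (hW : W.IsSymm) {σ η t K T : ℝ} (hσ : 0 ≤ σ)
    (hη : η ≤ 1 / 8) (hηt : 8 * η ^ 2 + 2 * η < 1 - t) (hσK : σ * K ≤ η * n)
    (hσT : σ * T ≤ t * n) (hnorm : ‖offDiagPart W‖ ≤ K)
    (hrow : ∀ i, -T ≤ z i * (offDiagPart W).mulVec z i) :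
    ExactRecovery (Matrix.vecMulVec z z + σ • W) z := by
  intro r hr Y hY
  have hz_sq (i) : z i * z i = 1 := by rcases hz i with h | h <;> simp [h]
  have hz_abs (i) : |z i| = 1 := by rcases hz i with h | h <;> simp [h]
  have hC : (Matrix.vecMulVec z z + σ • W).IsSymm :=
    .add (Matrix.transpose_vecMulVec z z) (hW.smul σ)
  let A := Matrix.diagonal z * offDiagPart W * Matrix.diagonal z
  have hA (i j) : A i j = z i * offDiagPart W i j * z j := by
    simp only [A, Matrix.mul_diagonal, Matrix.diagonal_mul]
  have hA_symm : A.IsSymm := Matrix.IsSymm.ext fun i j => by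
    rw [hA, hA, (isSymm_offDiagPart hW).apply]
    ring
  have key : IsSecondOrderPoint (Matrix.vecMulVec 1 1 + σ • A) (fun i => z i • Y i) _ :=
    diagonal_mul_vecMulVec_add_smul_mul_diagonal hz_sq σ ▸
      ((hY.isSecondOrderPoint hC).sub_diagonal (σ • W.diag)).sign_smul hz_sq
  have aligned (i j) : z i • Y i = z j • Y j := by
    refine key.eq_of_norm_le (by simpa using hr) (hA_symm.smul σ) (fun i => ?_) hη hηt ?_
      (fun i => ?_) i j
    · simp [hA, offDiagPart_apply_self]
    · calc ‖σ • A‖ ≤ σ * K := by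
            rw [norm_smul, Real.norm_of_nonneg hσ]
            gcongr
            exact (norm_diagonal_mul_mul_diagonal_le hz_abs).trans hnorm
        _ ≤ η * Fintype.card (Fin n) := by rwa [Fintype.card_fin]
    · calc -(t * Fintype.card (Fin n)) ≤ σ * -T := by rw [Fintype.card_fin]; linarith
        _ ≤ σ * (z i * (offDiagPart W).mulVec z i) := by gcongr; exact hrow i
        _ = ∑ j, (σ • A) i j := by
          simp only [Matrix.mulVec, dotProduct, Matrix.smul_apply, hA, smul_eq_mul,
            Finset.mul_sum, mul_assoc]
  ext i j
  have hYi : Y i = (z i * z j) • Y j := by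
    rw [mul_smul, ← aligned i j, smul_smul, hz_sq, one_smul]
  rw [Config.toMatrix_mul_transpose_apply, Matrix.vecMulVec_apply, hYi, real_inner_smul_left,
    real_inner_self_eq_norm_sq, hY.onSpheres j, one_pow, mul_one]

end ExactRecovery

section Net

open scoped InnerProductSpace Matrix.Norms.L2Operator

variable {E F : Type*} [NormedAddCommGroup E] [NormedAddCommGroup F]

lemma packingNumber_one_closedBall_two_le [NormedSpace ℝ E] [FiniteDimensional ℝ E] :
    Metric.packingNumber 1 (Metric.closedBall (0 : E) 2) ≤ (5 ^ Module.finrank ℝ E : ℕ) := by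
  refine iSup_le fun S => iSup_le fun hS => iSup_le fun hsep => ?_
  by_contra! hcard
  obtain ⟨T, hTS, hT⟩ := Set.exists_subset_encard_eq (Order.add_one_le_of_lt hcard)
  obtain ⟨T, rfl⟩ := (Set.finite_of_encard_eq_coe (k := 5 ^ Module.finrank ℝ E + 1)
    (by rw [hT, Nat.cast_add, Nat.cast_one])).exists_finset_coe
  have hT_le := Besicovitch.card_le_of_separated T
    (fun c hc => mem_closedBall_zero_iff.1 (hS (hTS hc))) fun c hc d hd hcd => by
      have h : ENNReal.ofReal 1 < ENNReal.ofReal ‖c - d‖ := by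
        rw [← dist_eq_norm, ← edist_dist, ENNReal.ofReal_one]
        exact hsep (hTS hc) (hTS hd) hcd
      exact (ENNReal.ofReal_lt_ofReal_iff'.1 h).1.le
  have : T.card = 5 ^ Module.finrank ℝ E + 1 := by
    rw [Set.encard_coe_eq_coe_finsetCard] at hT
    exact_mod_cast hT
  omega

lemma exists_finset_isCover_closedBall_two (E : Type*) [NormedAddCommGroup E] [NormedSpace ℝ E]
    [FiniteDimensional ℝ E] : ∃ N : Finset E, N.card ≤ 5 ^ Module.finrank ℝ E ∧
      (N : Set E) ⊆ Metric.closedBall 0 2 ∧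
      Metric.IsCover 1 (Metric.closedBall 0 2) (N : Set E) := by
  have hle := (Metric.coveringNumber_le_packingNumber 1 (Metric.closedBall (0 : E) 2)).trans
    packingNumber_one_closedBall_two_le
  obtain ⟨N, hN_subset, hN_finite, hN_cover, hN_card⟩ :=
    Metric.exists_set_encard_eq_coveringNumber (ne_top_of_le_ne_top (ENat.natCast_ne_top _) hle)
  obtain ⟨N, rfl⟩ := hN_finite.exists_finset_coe
  rw [← hN_card, Set.encard_coe_eq_coe_finsetCard] at hle
  exact ⟨N, Nat.cast_le.1 hle, hN_subset, hN_cover⟩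

lemma exists_norm_two_smul_sub_le [NormedSpace ℝ E] {N : Set E}
    (hN : Metric.IsCover 1 (Metric.closedBall 0 2) N) {x : E} (hx : ‖x‖ = 1) :
    ∃ p ∈ N, ‖(2 : ℝ) • x - p‖ ≤ 1 := by
  rw [Metric.isCover_iff_subset_iUnion_closedBall] at hN
  have h : (2 : ℝ) • x ∈ Metric.closedBall 0 2 := by simp [norm_smul, hx]
  obtain ⟨p, hp, hxp⟩ := Set.mem_iUnion₂.1 (hN h)
  exact ⟨p, hp, mem_closedBall_iff_norm.1 hxp⟩

variable [InnerProductSpace ℝ F]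

lemma norm_le_of_inner_le_of_isCover {N : Set F} (hN : Metric.IsCover 1 (Metric.closedBall 0 2) N)
    {v : F} {M : ℝ} (hM : 0 ≤ M) (h : ∀ p ∈ N, ⟪p, v⟫_ℝ ≤ M) : ‖v‖ ≤ M := by
  rcases eq_or_ne v 0 with rfl | hv
  · rwa [norm_zero]
  let x := NormedSpace.normalize v
  have hxv : ⟪x, v⟫_ℝ = ‖v‖ := by
    rw [← NormedSpace.norm_smul_normalize v, real_inner_smul_right, real_inner_self_eq_norm_sq,
      NormedSpace.norm_normalize hv, NormedSpace.norm_smul_normalize]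
    ring
  obtain ⟨p, hp, hxp⟩ := exists_norm_two_smul_sub_le hN (NormedSpace.norm_normalize hv)
  have : 2 * ‖v‖ ≤ ‖v‖ + M := by
    calc 2 * ‖v‖ = ⟪(2 : ℝ) • x - p, v⟫_ℝ + ⟪p, v⟫_ℝ := by
          rw [inner_sub_left, sub_add_cancel, real_inner_smul_left, hxv]
      _ ≤ 1 * ‖v‖ + M :=
          add_le_add ((real_inner_le_norm _ _).trans (by gcongr)) (h p hp)
      _ = ‖v‖ + M := by rw [one_mul]
  linarith

lemma opNorm_le_of_inner_le_of_isCover [NormedSpace ℝ E] {N : Set E} {N' : Set F}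
    (hN : Metric.IsCover 1 (Metric.closedBall 0 2) N)
    (hN' : Metric.IsCover 1 (Metric.closedBall 0 2) N') (T : E →L[ℝ] F) {M : ℝ} (hM : 0 ≤ M)
    (h : ∀ p ∈ N', ∀ q ∈ N, ⟪p, T q⟫_ℝ ≤ M) : ‖T‖ ≤ M := by
  have : ‖T‖ ≤ (M + ‖T‖) / 2 := by
    refine T.opNorm_le_of_unit_norm (by positivity) fun x hx => ?_
    obtain ⟨q, hq, hxq⟩ := exists_norm_two_smul_sub_le hN hx
    have hTq : ‖T q‖ ≤ M := norm_le_of_inner_le_of_isCover hN' hM fun p hp => h p hp q hq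
    have : 2 * ‖T x‖ ≤ M + ‖T‖ := by
      calc 2 * ‖T x‖ = ‖T q + T ((2 : ℝ) • x - q)‖ := by
            rw [← map_add, add_sub_cancel, map_smul, norm_smul, Real.norm_two]
        _ ≤ ‖T q‖ + ‖T‖ * ‖(2 : ℝ) • x - q‖ :=
            (norm_add_le _ _).trans (by gcongr; exact T.le_opNorm _)
        _ ≤ M + ‖T‖ * 1 := by gcongr
        _ = M + ‖T‖ := by rw [mul_one]
    linarith
  linarith

lemma l2_opNorm_le_of_dotProduct_le_of_isCover {ι : Type*} [Fintype ι] [DecidableEq ι]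
    {N : Set (EuclideanSpace ℝ ι)} (hN : Metric.IsCover 1 (Metric.closedBall 0 2) N)
    (A : Matrix ι ι ℝ) {M : ℝ} (hM : 0 ≤ M)
    (h : ∀ p ∈ N, ∀ q ∈ N, p.ofLp ⬝ᵥ A.mulVec q.ofLp ≤ M) : ‖A‖ ≤ M := by
  refine opNorm_le_of_inner_le_of_isCover hN hN (Matrix.toEuclideanCLM (𝕜 := ℝ) A) hM
    fun p hp q hq => ?_
  simpa [EuclideanSpace.inner_eq_star_dotProduct, dotProduct_comm] using h p hp q hq

end Net

section Noise

open MeasureTheory ProbabilityTheory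
open scoped Matrix.Norms.L2Operator

section Pairs

variable {ι : Type*} [Fintype ι] [LinearOrder ι]

lemma sum_sum_eq_sum_lt_add_sum_diag (F : ι → ι → ℝ) :
    ∑ i, ∑ j, F i j = ∑ k : {k : ι × ι // k.1 < k.2}, (F k.1.1 k.1.2 + F k.1.2 k.1.1) +
      ∑ i, F i i := by
  have sum_lt (G : ι → ι → ℝ) : ∑ k : {k : ι × ι // k.1 < k.2}, G k.1.1 k.1.2 =
      ∑ i, ∑ j, if i < j then G i j else 0 := by
    rw [← Fintype.sum_prod_type' (f := fun i j => if i < j then G i j else 0),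
      ← Finset.sum_filter]
    exact (Finset.sum_subtype _ (by simp) fun k : ι × ι => G k.1 k.2).symm
  have sum_diag : ∑ i, F i i = ∑ i, ∑ j, if i = j then F i j else 0 := by simp
  rw [Finset.sum_add_distrib, sum_lt F, sum_lt fun i j => F j i,
    Finset.sum_comm (f := fun i j => if i < j then F j i else 0), sum_diag]
  simp only [← Finset.sum_add_distrib]
  refine Finset.sum_congr rfl fun i _ => Finset.sum_congr rfl fun j _ => ?_
  rcases lt_trichotomy i j with h | rfl | h
  · simp [h, h.ne, h.not_gt]
  · simp
  · simp [h, h.ne', h.not_gt]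

lemma dotProduct_offDiagPart_mulVec {A : Matrix ι ι ℝ} (hA : A.IsSymm) (p q : ι → ℝ) :
    p ⬝ᵥ (offDiagPart A).mulVec q = ∑ k : {k : ι × ι // k.1 < k.2},
      (p k.1.1 * q k.1.2 + p k.1.2 * q k.1.1) * A k.1.1 k.1.2 := by
  simp only [dotProduct, Matrix.mulVec, Finset.mul_sum]
  rw [sum_sum_eq_sum_lt_add_sum_diag]
  simp only [offDiagPart_apply_self, zero_mul, mul_zero, Finset.sum_const_zero, add_zero]
  refine Finset.sum_congr rfl fun k _ => ?_
  rw [offDiagPart_apply_of_ne k.2.ne, offDiagPart_apply_of_ne k.2.ne', hA.apply]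
  ring

lemma sum_lt_mul_add_mul_sq (p q : ι → ℝ) :
    ∑ k : {k : ι × ι // k.1 < k.2}, (p k.1.1 * q k.1.2 + p k.1.2 * q k.1.1) ^ 2 =
      (∑ i, p i ^ 2) * (∑ i, q i ^ 2) + (∑ i, p i * q i) ^ 2 - 2 * ∑ i, (p i * q i) ^ 2 := by
  have expand : ∑ i, ∑ j, (p i * q j + p j * q i) ^ 2 =
      2 * ((∑ i, p i ^ 2) * (∑ i, q i ^ 2) + (∑ i, p i * q i) ^ 2) := by
    calc ∑ i, ∑ j, (p i * q j + p j * q i) ^ 2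
        = ∑ i, ∑ j, (p i ^ 2 * q j ^ 2 + q i ^ 2 * p j ^ 2 + 2 * ((p i * q i) * (p j * q j))) :=
          Finset.sum_congr rfl fun i _ => Finset.sum_congr rfl fun j _ => by ring
      _ = _ := by
          simp only [Finset.sum_add_distrib, ← Finset.mul_sum, ← Finset.sum_mul]
          ring
  rw [sum_sum_eq_sum_lt_add_sum_diag] at expand
  simp only [add_comm (p _ * q _) (p _ * q _), ← two_mul, mul_pow (2 : ℝ), ← Finset.mul_sum]
    at expand
  linarith

end Pairs

/-- `W` is a random symmetric matrix whose entries above the diagonal are independent and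
sub-Gaussian with variance proxy `1`. As for Gaussian noise, nothing is required of the diagonal. -/
structure IsSubgaussianNoise {Ω : Type*} [MeasurableSpace Ω] (P : Measure Ω) {ι : Type*} [LT ι]
    (W : Ω → Matrix ι ι ℝ) : Prop where
  symm : ∀ ω, (W ω).IsSymm
  hasSubgaussianMGF : ∀ i j, i < j → HasSubgaussianMGF (fun ω => W ω i j) 1 P
  indep : iIndepFun (fun (k : {k : ι × ι // k.1 < k.2}) ω => W ω k.1.1 k.1.2) P

variable {Ω : Type*} [MeasurableSpace Ω] {P : Measure Ω}

lemma hasSubgaussianMGF_of_hasLaw_gaussianReal {X : Ω → ℝ} {v : NNReal}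
    (hX : HasLaw X (gaussianReal 0 v) P) : HasSubgaussianMGF X v P := by
  refine (HasSubgaussianMGF.id_map_iff hX.aemeasurable).1 ?_
  rw [hX.map_eq]
  exact ⟨fun t => integrable_exp_mul_gaussianReal t, fun t => by simp [mgf_id_gaussianReal]⟩

lemma IsGaussianNoise.isSubgaussianNoise {n : ℕ} {W : Ω → Matrix (Fin n) (Fin n) ℝ}
    (hW : IsGaussianNoise P W) : IsSubgaussianNoise P W where
  symm := hW.symm
  hasSubgaussianMGF i j hij := hasSubgaussianMGF_of_hasLaw_gaussianReal (hW.law i j hij)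
  indep := hW.indep

namespace IsSubgaussianNoise

variable {ι : Type*} [Fintype ι] [LinearOrder ι] {W : Ω → Matrix ι ι ℝ}

lemma measureReal_le_dotProduct_mulVec_le (hW : IsSubgaussianNoise P W) (p q : ι → ℝ)
    {v T : ℝ} (hv : 0 ≤ v) (hpq : (∑ i, p i ^ 2) * (∑ i, q i ^ 2) + (∑ i, p i * q i) ^ 2 -
      2 * ∑ i, (p i * q i) ^ 2 ≤ v) (hT : 0 ≤ T) :
    P.real {ω | T ≤ p ⬝ᵥ (offDiagPart (W ω)).mulVec q} ≤ Real.exp (-T ^ 2 / (2 * v)) := by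
  let c (k : {k : ι × ι // k.1 < k.2}) : ℝ := p k.1.1 * q k.1.2 + p k.1.2 * q k.1.1
  have hind : iIndepFun (fun k ω => c k * W ω k.1.1 k.1.2) P :=
    hW.indep.comp (fun k x => c k * x) fun k => measurable_const_mul _
  have hsum := HasSubgaussianMGF.sum_of_iIndepFun hind (s := Finset.univ) fun k _ =>
    (hW.hasSubgaussianMGF k.1.1 k.1.2 k.2).const_mul (c k)
  have hsum_v : HasSubgaussianMGF (fun ω => ∑ k, c k * W ω k.1.1 k.1.2) ⟨v, hv⟩ P := by
    refine ⟨hsum.integrable_exp_mul, fun t => (hsum.mgf_le t).trans ?_⟩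
    gcongr
    refine le_of_eq_of_le ?_ ((sum_lt_mul_add_mul_sq p q).trans_le hpq)
    rw [NNReal.coe_sum]
    exact Finset.sum_congr rfl fun k _ => mul_one _
  simp only [dotProduct_offDiagPart_mulVec (hW.symm _)]
  exact hsum_v.measure_ge_le hT

lemma measureReal_lt_norm_offDiagPart_le [IsFiniteMeasure P] (hW : IsSubgaussianNoise P W) :
    P.real {ω | 16 * √(Fintype.card ι) < ‖offDiagPart (W ω)‖} ≤
      (25 * Real.exp (-4)) ^ Fintype.card ι := by
  obtain ⟨N, hcard, hN_norm, hN⟩ := exists_finset_isCover_closedBall_two (EuclideanSpace ℝ ι)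
  have sum_sq_le (p) (hp : p ∈ N) : ∑ i, p i ^ 2 ≤ 4 := by
    have := mem_closedBall_zero_iff.1 (hN_norm hp)
    rw [← EuclideanSpace.real_norm_sq_eq]
    nlinarith [norm_nonneg p]
  let B (k : EuclideanSpace ℝ ι × EuclideanSpace ℝ ι) : Set Ω :=
    {ω | 16 * √(Fintype.card ι) ≤ k.1.ofLp ⬝ᵥ (offDiagPart (W ω)).mulVec k.2.ofLp}
  have subset : {ω | 16 * √(Fintype.card ι) < ‖offDiagPart (W ω)‖} ⊆ ⋃ k ∈ N ×ˢ N, B k := by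
    refine fun ω hω => by_contra fun hB => (Set.mem_ofPred.1 hω).not_ge ?_
    simp only [B, Set.mem_iUnion, Finset.mem_product, Set.mem_ofPred_eq, not_exists, not_le] at hB
    exact l2_opNorm_le_of_dotProduct_le_of_isCover hN _ (by positivity)
      fun p hp q hq => (hB (p, q) ⟨hp, hq⟩).le
  have bound (k) (hk : k ∈ N ×ˢ N) : P.real (B k) ≤ Real.exp (-4) ^ Fintype.card ι := by
    obtain ⟨hp, hq⟩ := Finset.mem_product.1 hk
    have variance_le : (∑ i, k.1 i ^ 2) * (∑ i, k.2 i ^ 2) + (∑ i, k.1 i * k.2 i) ^ 2 -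
        2 * ∑ i, (k.1 i * k.2 i) ^ 2 ≤ 32 := by
      have hpq := Finset.sum_mul_sq_le_sq_mul_sq Finset.univ (fun i => k.1 i) fun i => k.2 i
      have hle : (∑ i, k.1 i ^ 2) * (∑ i, k.2 i ^ 2) ≤ 4 * 4 :=
        mul_le_mul (sum_sq_le _ hp) (sum_sq_le _ hq) (by positivity) (by norm_num)
      have : 0 ≤ ∑ i, (k.1 i * k.2 i) ^ 2 := by positivity
      linarith
    refine (hW.measureReal_le_dotProduct_mulVec_le _ _ (by norm_num) variance_le
      (by positivity)).trans_eq ?_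
    rw [← Real.exp_nat_mul, mul_pow, Real.sq_sqrt (Nat.cast_nonneg _)]
    ring_nf
  calc P.real {ω | 16 * √(Fintype.card ι) < ‖offDiagPart (W ω)‖}
      ≤ ∑ k ∈ N ×ˢ N, P.real (B k) :=
        (measureReal_mono subset (measure_ne_top _ _)).trans (measureReal_biUnion_finset_le _ _)
    _ ≤ (N.card * N.card : ℕ) * Real.exp (-4) ^ Fintype.card ι := by
        rw [← Finset.card_product, ← nsmul_eq_mul]
        exact Finset.sum_le_card_nsmul _ _ _ bound
    _ ≤ (5 ^ Fintype.card ι * 5 ^ Fintype.card ι : ℕ) * Real.exp (-4) ^ Fintype.card ι := by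
        rw [finrank_euclideanSpace] at hcard
        gcongr
    _ = (25 * Real.exp (-4)) ^ Fintype.card ι := by
        rw [← mul_pow, Nat.cast_pow, ← mul_pow]
        norm_num

lemma measureReal_exists_mul_mulVec_lt_le [IsFiniteMeasure P] (hW : IsSubgaussianNoise P W)
    {z : ι → ℝ} (hz : ∀ i, z i ^ 2 = 1) {T : ℝ} (hT : 0 ≤ T) :
    P.real {ω | ∃ i, z i * (offDiagPart (W ω)).mulVec z i < -T} ≤
      Fintype.card ι * Real.exp (-T ^ 2 / (2 * Fintype.card ι)) := by
  let B (i : ι) : Set Ω := {ω | T ≤ Pi.single i (-z i) ⬝ᵥ (offDiagPart (W ω)).mulVec z}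
  have subset : {ω | ∃ i, z i * (offDiagPart (W ω)).mulVec z i < -T} ⊆
      ⋃ i ∈ Finset.univ, B i := by
    rintro ω ⟨i, hi⟩
    refine Set.mem_iUnion₂.2 ⟨i, Finset.mem_univ i, ?_⟩
    rw [Set.mem_ofPred, single_dotProduct]
    linarith
  have bound (i : ι) : P.real (B i) ≤ Real.exp (-T ^ 2 / (2 * Fintype.card ι)) := by
    refine hW.measureReal_le_dotProduct_mulVec_le _ _ (Nat.cast_nonneg _) ?_ hT
    simp [Pi.single_apply, hz, mul_pow, ite_pow]
  calc P.real {ω | ∃ i, z i * (offDiagPart (W ω)).mulVec z i < -T}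
      ≤ ∑ i, P.real (B i) :=
        (measureReal_mono subset (measure_ne_top _ _)).trans (measureReal_biUnion_finset_le _ _)
    _ ≤ ∑ _i : ι, Real.exp (-T ^ 2 / (2 * Fintype.card ι)) :=
        Finset.sum_le_sum fun i _ => bound i
    _ = Fintype.card ι * Real.exp (-T ^ 2 / (2 * Fintype.card ι)) := by
        rw [Finset.sum_const, Finset.card_univ, nsmul_eq_mul]

end IsSubgaussianNoise

end Noise

section Probability

open MeasureTheory Filter
open scoped Topology Matrix.Norms.L2Operator

lemma IsSubgaussianNoise.measureReal_compl_exactRecovery_le {Ω : Type*} [MeasurableSpace Ω]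
    {P : Measure Ω} [IsFiniteMeasure P] {n : ℕ} {W : Ω → Matrix (Fin n) (Fin n) ℝ}
    (hW : IsSubgaussianNoise P W) {z : Fin n → ℝ} (hz : ∀ i, z i = 1 ∨ z i = -1) {σ η t T : ℝ}
    (hσ : 0 ≤ σ) (hη : η ≤ 1 / 8) (hηt : 8 * η ^ 2 + 2 * η < 1 - t)
    (hση : σ * (16 * √n) ≤ η * n) (hσT : σ * T ≤ t * n) (hT : 0 ≤ T) :
    P.real {ω | ExactRecovery (Matrix.vecMulVec z z + σ • W ω) z}ᶜ ≤
      (25 * Real.exp (-4)) ^ n + n * Real.exp (-T ^ 2 / (2 * n)) := by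
  have subset : {ω | ExactRecovery (Matrix.vecMulVec z z + σ • W ω) z}ᶜ ⊆
      {ω | 16 * √n < ‖offDiagPart (W ω)‖} ∪
        {ω | ∃ i, z i * (offDiagPart (W ω)).mulVec z i < -T} := by
    refine fun ω hω => by_contra fun h => hω ?_
    simp only [Set.mem_union, Set.mem_ofPred_eq, not_or, not_lt, not_exists] at h
    exact exactRecovery_of_norm_le hz (hW.symm ω) hσ hη hηt hση hσT h.1 h.2
  have hnorm := hW.measureReal_lt_norm_offDiagPart_le
  have hrow := hW.measureReal_exists_mul_mulVec_lt_le (z := z)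
    (fun i => sq_eq_one_iff.2 (hz i)) hT
  rw [Fintype.card_fin] at hnorm hrow
  exact (measureReal_mono subset (measure_ne_top _ _)).trans
    ((measureReal_union_le _ _).trans (add_le_add hnorm hrow))

lemma exists_measurableSet_subset_tendsto_one {ι : Type*} {l : Filter ι} {Ω : ι → Type*}
    [∀ i, MeasurableSpace (Ω i)] (P : ∀ i, Measure (Ω i)) [∀ i, IsProbabilityMeasure (P i)]
    {G : ∀ i, Set (Ω i)} (hG : Tendsto (fun i => (P i).real (G i)ᶜ) l (𝓝 0)) :
    ∃ E : ∀ i, Set (Ω i), (∀ i, MeasurableSet (E i)) ∧ Tendsto (fun i => P i (E i)) l (𝓝 1) ∧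
      ∀ i, E i ⊆ G i := by
  refine ⟨fun i => (toMeasurable (P i) (G i)ᶜ)ᶜ, fun i => (measurableSet_toMeasurable _ _).compl,
    ?_, fun i => Set.compl_subset_comm.1 (subset_toMeasurable _ _)⟩
  simp only [prob_compl_eq_one_sub (measurableSet_toMeasurable _ _), measure_toMeasurable]
  have hG' : Tendsto (fun i => P i (G i)ᶜ) l (𝓝 0) := by
    simpa only [ofReal_measureReal (measure_ne_top _ _), ENNReal.ofReal_zero] using
      ENNReal.tendsto_ofReal hG
  simpa only [tsub_zero] using
    ENNReal.Tendsto.sub (tendsto_const_nhds (x := 1)) hG' (.inl ENNReal.one_ne_top)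

lemma tendsto_log_natCast_atTop : Tendsto (fun n : ℕ => Real.log n) atTop atTop :=
  Real.tendsto_log_atTop.comp tendsto_natCast_atTop_atTop

lemma twentyFive_mul_exp_neg_four_lt_one : 25 * Real.exp (-4) < 1 := by
  rw [Real.exp_neg, ← div_eq_mul_inv, div_lt_one (Real.exp_pos _)]
  calc (25 : ℝ) < 2.7 ^ 4 := by norm_num
    _ ≤ Real.exp 1 ^ 4 := by gcongr; linarith [Real.exp_one_gt_d9]
    _ = Real.exp 4 := by rw [← Real.exp_nat_mul]; norm_num

lemma tendsto_natCast_mul_exp_neg_sq_div {a t : ℝ} (ha : 0 ≤ a) (hat : 2 < t ^ 2 * a) :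
    Tendsto (fun n : ℕ => n * Real.exp (-(t * √(n * (a * Real.log n))) ^ 2 / (2 * n)))
      atTop (𝓝 0) := by
  have hexp : Tendsto (fun n : ℕ => Real.exp ((1 - t ^ 2 * a / 2) * Real.log n)) atTop (𝓝 0) :=
    Real.tendsto_exp_atBot.comp
      (tendsto_log_natCast_atTop.const_mul_atTop_of_neg (by linarith))
  refine hexp.congr' ?_
  filter_upwards [eventually_ne_atTop 0] with n hn
  have : 0 ≤ Real.log n := Real.log_natCast_nonneg n
  have hsq : -(t * √(n * (a * Real.log n))) ^ 2 / (2 * n) = -(t ^ 2 * a / 2 * Real.log n) := by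
    rw [mul_pow, Real.sq_sqrt (by positivity)]
    field_simp
  rw [hsq, sub_mul, one_mul, sub_eq_add_neg, Real.exp_add, Real.exp_log (by positivity)]

lemma mul_sqrt_mul_le_of_le_sqrt_div {s x y : ℝ} (hx : 0 ≤ x) (hs : s ≤ √(x / y)) :
    s * √(x * y) ≤ x := by
  rcases le_or_gt y 0 with hy | hy
  · rwa [Real.sqrt_eq_zero_of_nonpos (mul_nonpos_of_nonneg_of_nonpos hx hy), mul_zero]
  · calc s * √(x * y) ≤ √(x / y) * √(x * y) := by gcongr
      _ = √(x ^ 2) := by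
        rw [← Real.sqrt_mul (by positivity)]
        congr 1
        field_simp
      _ = x := Real.sqrt_sq hx

lemma eventually_mul_sqrt_le {σ : ℕ → ℝ} (hσ_nonneg : ∀ n, 0 ≤ σ n) {a η : ℝ} (ha : 0 < a)
    (hη : 0 < η) (hσ : ∀ᶠ n : ℕ in atTop, σ n ≤ √(n / (a * Real.log n))) (K : ℝ) :
    ∀ᶠ n : ℕ in atTop, σ n * (K * √n) ≤ η * n := by
  have hsqrt : Tendsto (fun n : ℕ => η * √(a * Real.log n)) atTop atTop :=
    (Real.tendsto_sqrt_atTop.comp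
      (tendsto_log_natCast_atTop.const_mul_atTop ha)).const_mul_atTop hη
  filter_upwards [hσ, hsqrt.eventually_ge_atTop K] with n hσn hK
  calc σ n * (K * √n) ≤ σ n * (η * √(a * Real.log n) * √n) := by
        gcongr
        exact hσ_nonneg n
    _ = η * (σ n * √(n * (a * Real.log n))) := by
        rw [Real.sqrt_mul n.cast_nonneg]
        ring
    _ ≤ η * n := by
        gcongr
        exact mul_sqrt_mul_le_of_le_sqrt_div n.cast_nonneg hσn

lemma exists_lt_one_two_lt_sq_mul {a : ℝ} (ha : 2 < a) :
    ∃ t : ℝ, 0 < t ∧ t < 1 ∧ 2 < t ^ 2 * a := by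
  refine ⟨(2 + a) / (2 * a), by positivity, ?_, ?_⟩
  · rw [div_lt_one (by positivity)]
    linarith
  · rw [div_pow, div_mul_eq_mul_div, lt_div_iff₀ (by positivity)]
    nlinarith [mul_pos (sub_pos.2 ha) (sub_pos.2 ha)]

theorem theorem3p1_general (ε : ℝ) (hε : 0 < ε)
    (z : ∀ n : ℕ, Fin n → ℝ) (hz : ∀ n i, z n i = 1 ∨ z n i = -1)
    (σ : ℕ → ℝ) (hσ_nonneg : ∀ n, 0 ≤ σ n)
    (hσ : ∀ᶠ n : ℕ in atTop, σ n ≤ √(n / ((2 + ε) * Real.log n)))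
    {Ω : ℕ → Type*} [∀ n, MeasurableSpace (Ω n)]
    (P : ∀ n, Measure (Ω n)) [∀ n, IsProbabilityMeasure (P n)]
    (W : ∀ n, Ω n → Matrix (Fin n) (Fin n) ℝ) (hW : ∀ n, IsSubgaussianNoise (P n) (W n)) :
    ∃ E : ∀ n, Set (Ω n), (∀ n, MeasurableSet (E n)) ∧
      Tendsto (fun n => P n (E n)) atTop (𝓝 1) ∧
      ∀ n, ∀ ω ∈ E n, ExactRecovery (Matrix.vecMulVec (z n) (z n) + σ n • W n ω) (z n) := by
  refine exists_measurableSet_subset_tendsto_one P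
    (G := fun n => {ω | ExactRecovery (Matrix.vecMulVec (z n) (z n) + σ n • W n ω) (z n)}) ?_
  obtain ⟨t, ht_pos, ht_lt, ht⟩ := exists_lt_one_two_lt_sq_mul (a := 2 + ε) (by linarith)
  have hbound : Tendsto (fun n : ℕ => (25 * Real.exp (-4)) ^ n +
      n * Real.exp (-(t * √(n * ((2 + ε) * Real.log n))) ^ 2 / (2 * n))) atTop (𝓝 0) := by
    simpa only [add_zero] using
      (tendsto_pow_atTop_nhds_zero_of_lt_one (by positivity)
        twentyFive_mul_exp_neg_four_lt_one).add
      (tendsto_natCast_mul_exp_neg_sq_div (by positivity) ht)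
  refine squeeze_zero' (.of_forall fun n => measureReal_nonneg) ?_ hbound
  have hη : 0 < (1 - t) / 8 := by linarith
  filter_upwards [hσ, eventually_mul_sqrt_le hσ_nonneg (by positivity) hη hσ 16] with n hσn hση
  refine (hW n).measureReal_compl_exactRecovery_le (t := t) (hz n) (hσ_nonneg n) (by linarith)
    (by nlinarith) hση ?_ (by positivity)
  calc σ n * (t * √(n * ((2 + ε) * Real.log n)))
      = t * (σ n * √(n * ((2 + ε) * Real.log n))) := by ring
    _ ≤ t * n := by
        gcongr
        exact mul_sqrt_mul_le_of_le_sqrt_div n.cast_nonneg hσn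

end Probability

theorem theorem3p1 (ε : ℝ) (hε : 0 < ε)
    (z : ∀ n : ℕ, Fin n → ℝ) (hz : ∀ n i, z n i = 1 ∨ z n i = -1)
    (σ : ℕ → ℝ) (hσ_nonneg : ∀ n, 0 ≤ σ n)
    (hσ : ∀ᶠ n : ℕ in Filter.atTop, σ n ≤ Real.sqrt (n / ((2 + ε) * Real.log n)))
    {Ω : ℕ → Type*} [∀ n, MeasurableSpace (Ω n)]
    (P : ∀ n, MeasureTheory.Measure (Ω n)) [∀ n, MeasureTheory.IsProbabilityMeasure (P n)]
    (W : ∀ n, Ω n → Matrix (Fin n) (Fin n) ℝ) (hW : ∀ n, IsGaussianNoise (P n) (W n))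
    (C : ∀ n, Ω n → Matrix (Fin n) (Fin n) ℝ)
    (hC : ∀ n ω, C n ω = Matrix.vecMulVec (z n) (z n) + σ n • W n ω) :
    ∃ E : ∀ n, Set (Ω n),
      (∀ n, MeasurableSet (E n)) ∧
      Filter.Tendsto (fun n => P n (E n)) Filter.atTop (nhds 1) ∧
      ∀ n, ∀ ω ∈ E n, ∀ r : ℕ, 2 ≤ r → ∀ Y : Config n r,
        Config.IsSecondOrderCritical (syncObjective (C n ω) r) Y →
          Y.toMatrix * Y.toMatrix.transpose = Matrix.vecMulVec (z n) (z n) := by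
  simp only [hC]
  exact theorem3p1_general ε hε z hz σ hσ_nonneg hσ P W fun n => (hW n).isSubgaussianNoise
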